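/- Let $k$ be a field, and let $\mathcal T$ be a $k$-linear, Hom-finite, Krull–Schmidt triangulated category with suspension $\Sigma$. For a collection $\mathcal C$ of objects write $\langle\mathcal C\rangle$ for its extension closure (the smallest extension-closed full subcategory containing $\mathcal C$ and the zero objects), ${}^\perp\mathcal C$ and $\mathcal C^\perp$ for its left and right Hom-orthogonals, $\Sigma^{\ge 0}\mathcal C=\{\Sigma^iC : C\in\mathcal C,\ i\ge 0\}$ and similarly $\Sigma^{<0}\mathcal C$. For subcategories $\mathcal A,\mathcal B$ let $\mathcal A*\mathcal B$ be the full subcategory of objects $X$ admitting a triangle $A\to X\to B\to\Sigma A$ with $A\in\mathcal A$, $B\in\mathcal B$. Put $D=\operatorname{Hom}_k(-,k)$. Let $d\ge 1$ be an integer and let $(\mathcal T,\mathcal T^p,\mathcal S)$ be a $(-d)$-Calabi–Yau triple with $\mathcal S=\operatorname{add}(S_1\oplus\dots\oplus S_m)$; that is: 1. $\mathcal T^p\subseteq\mathcal T$ is a thick subcategory, and there is an isomorphism $D\mathcal T(X,Y)\cong\mathcal T(Y,\Sigma^{-d}X)$, natural in $X\in\mathcal T^p$ and $Y\in\mathcal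 T$; 2. $\{S_1,\dots,S_m\}$ is a simple minded collection in $\mathcal T$: $\mathcal T(S_i,\Sigma^{n}S_j)=0$ for all $i,j$ and $n<0$; $\dim_k\mathcal T(S_i,S_j)=\delta_{ij}$; and the smallest thick subcategory of $\mathcal T$ containing all the $S_i$ is $\mathcal T$; 3. $\big({}^\perp(\Sigma^{\ge0}\mathcal S),{}^\perp(\Sigma^{<0}\mathcal S)\big)$ and $\big((\Sigma^{\ge0}\mathcal S)^\perp,(\Sigma^{<0}\mathcal S)^\perp\big)$ are co-t-structures on $\mathcal T$, where a co-t-structure is a pair $(\mathcal A,\mathcal B)$ of full subcategories closed under direct summands with $\mathcal T(\mathcal A,\mathcal B)=0$, $\mathcal T=\mathcal A*\mathcal B$, $\Sigma^{-1}\mathcal A\subseteq\mathcal A$ and $\Sigma\mathcal B\subseteq\mathcal B$; moreover ${}^\perp(\Sigma^{\ge0}\mathcal S)\subseteq\mathcal T^p$ and $(\Sigma^{<0}\mathcal S)^\perp\subseteq\mathcal T^p$. Then the Verdier quotient $\mathcal T/\mathcal T^p$ is Hom-finite and Krull–Schmidt, and $S_1,\dots,S_m$ form a $(d+1)$-simple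 minded system in it. This means: - $\dim_k(\mathcal T/\mathcal T^p)(S_i,S_j)=\delta_{ij}$ for all $i,j$; - $(\mathcal T/\mathcal T^p)(\Sigma^nS_i,S_j)=0$ for all $i,j$ and $1\le n\le d$; - $\mathcal T/\mathcal T^p=\langle\mathcal S\rangle*\Sigma^{-1}\langle\mathcal S\rangle*\dots*\Sigma^{-d}\langle\mathcal S\rangle$, where $\langle\mathcal S\rangle$ is the extension closure of $\{S_1,\dots,S_m\}$ in $\mathcal T/\mathcal T^p$. -/

import Mathlib

open CategoryTheory CategoryTheory.Limits CategoryTheory.Pretriangulated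

namespace NegCluster

section Linear

/-- All Hom-spaces of the `k`-linear category `C` are finite dimensional. -/
def IsHomFinite (k : Type*) [Field k] (C : Type*) [Category* C] [Preadditive C] [Linear k C] :
    Prop :=
  ∀ X Y : C, Module.Finite k (X ⟶ Y)

/-- Every object is a finite direct sum of objects with local endomorphism ring. -/
def IsKrullSchmidt (C : Type*) [Category* C] [Preadditive C] : Prop :=
  ∀ X : C, ∃ (n : ℕ) (f : Fin n → C), (∀ i, IsLocalRing (End (f i))) ∧
    ∃ b : Bicone f, Nonempty b.IsBilimit ∧ Nonempty (b.pt ≅ X)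

end Linear

section Triangulated

variable {C : Type*} [Category* C] [Preadditive C] [HasZeroObject C] [HasShift C ℤ]
  [∀ n : ℤ, (shiftFunctor C n).Additive] [Pretriangulated C]

/-- The objects `Σⁿ Sᵢ` with `n ∈ I` (up to isomorphism). -/
def shifts {ι : Type*} (S : ι → C) (I : Set ℤ) : ObjectProperty C :=
  fun X => ∃ i, ∃ n ∈ I, Nonempty (X ≅ (S i)⟦n⟧)

/-- The extension closure `⟨P⟩`: the smallest full subcategory which contains the zero objects
and the objects of `P` and which is closed under extensions. It is automatically closed under
isomorphisms, because `X ⟶ Y ⟶ 0 ⟶ X⟦1⟧` is distinguished when `X ⟶ Y` is an isomorphism. -/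
inductive extClosure (P : ObjectProperty C) : ObjectProperty C
  | zero (X : C) (hX : IsZero X) : extClosure P X
  | of (X : C) (hX : P X) : extClosure P X
  | ext (X Y Z : C) (f : X ⟶ Y) (g : Y ⟶ Z) (h : Z ⟶ X⟦(1 : ℤ)⟧)
      (hT : Triangle.mk f g h ∈ distTriang C) (hX : extClosure P X) (hZ : extClosure P Z) :
      extClosure P Y

/-- `A 0 * A 1 * ⋯ * A (n - 1)`, where `X` lies in `P * Q` when there is a distinguished triangle
`Y ⟶ X ⟶ Z ⟶ Y⟦1⟧` with `Y` in `P` and `Z` in `Q`; the product of no factors consists of the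
zero objects. -/
def starProduct (A : ℕ → ObjectProperty C) : ℕ → ObjectProperty C
  | 0 => fun X => IsZero X
  | n + 1 => ObjectProperty.extensionProduct (starProduct A n) (A n)

/-- `(P, Q)` is a co-t-structure `P ⊥ Q`. -/
structure IsCoTStructure (P Q : ObjectProperty C) : Prop where
  retract_left : P.IsStableUnderRetracts
  retract_right : Q.IsStableUnderRetracts
  hom_eq_zero : ∀ (X Y : C), P X → Q Y → ∀ f : X ⟶ Y, f = 0
  exists_triangle : ∀ X : C, ObjectProperty.extensionProduct P Q X
  shift_left : ∀ X : C, P X → P (X⟦(-1 : ℤ)⟧)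
  shift_right : ∀ X : C, Q X → Q (X⟦(1 : ℤ)⟧)

/-- The pairwise distinct objects `Sᵢ` form a simple minded collection. The last field says that
every thick subcategory containing all the `Sᵢ` is everything. -/
structure IsSMC (k : Type*) [Field k] [Linear k C] {ι : Type*} (S : ι → C) : Prop where
  hom_neg_shift : ∀ (i j : ι) (n : ℤ), n < 0 → ∀ f : S i ⟶ (S j)⟦n⟧, f = 0
  finrank_self : ∀ i, Module.finrank k (S i ⟶ S i) = 1
  finrank_of_ne : ∀ i j, i ≠ j → Module.finrank k (S i ⟶ S j) = 0
  thick_eq_top : ∀ P : ObjectProperty C, P.IsTriangulated → P.IsStableUnderRetracts →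
    (∀ i, P (S i)) → ∀ X, P X

/-- A bifunctorial isomorphism `T(Y, Σ⁻ᵈ X) ≅ D T(X, Y)` for `X` in `P` and `Y` arbitrary,
where `D` is the `k`-dual. -/
structure RelativeDuality (k : Type*) [Field k] [Linear k C] (P : ObjectProperty C) (d : ℕ) where
  iso (X Y : C) (hX : P X) : (Y ⟶ X⟦(-(d : ℤ))⟧) ≃ₗ[k] Module.Dual k (X ⟶ Y)
  natural_left (X X' Y : C) (hX : P X) (hX' : P X') (a : X ⟶ X') (h : Y ⟶ X⟦(-(d : ℤ))⟧)
    (u : X' ⟶ Y) : iso X' Y hX' (h ≫ a⟦(-(d : ℤ))⟧') u = iso X Y hX h (a ≫ u)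
  natural_right (X Y Y' : C) (hX : P X) (b : Y' ⟶ Y) (h : Y ⟶ X⟦(-(d : ℤ))⟧)
    (u : X ⟶ Y') : iso X Y' hX (b ≫ h) u = iso X Y hX h (u ≫ b)

/-- `(C, P, add (⨁ Sᵢ))` is a `(-d)`-Calabi-Yau triple. (That `Σ⁻ᵈ` restricts to an
autoequivalence of `P` is automatic.) -/
structure IsNegCYTriple (k : Type*) [Field k] [Linear k C] (P : ObjectProperty C) {ι : Type*}
    (S : ι → C) (d : ℕ) : Prop where
  homFinite : IsHomFinite k C
  krullSchmidt : IsKrullSchmidt C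
  triangulated : P.IsTriangulated
  retracts : P.IsStableUnderRetracts
  duality : Nonempty (RelativeDuality k P d)
  smc : IsSMC k S
  coT_left : IsCoTStructure (shifts S (Set.Ici 0)).leftOrthogonal
    (shifts S (Set.Iio 0)).leftOrthogonal
  coT_right : IsCoTStructure (shifts S (Set.Ici 0)).rightOrthogonal
    (shifts S (Set.Iio 0)).rightOrthogonal
  left_le : (shifts S (Set.Ici 0)).leftOrthogonal ≤ P
  right_le : (shifts S (Set.Iio 0)).rightOrthogonal ≤ P

/-- The objects `Sᵢ` form an `n`-simple minded system, for `C` Hom-finite and Krull-Schmidt.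
Note that `Σ⁻ʲ P` is written `P.shift j`, the property that `X⟦j⟧` is in `P`. -/
structure IsSMS (k : Type*) [Field k] [Linear k C] (n : ℕ) {ι : Type*} (S : ι → C) : Prop where
  one_le : 1 ≤ n
  finrank_self : ∀ i, Module.finrank k (S i ⟶ S i) = 1
  finrank_of_ne : ∀ i j, i ≠ j → Module.finrank k (S i ⟶ S j) = 0
  hom_shift : ∀ (i j : ι) (m : ℤ), 1 ≤ m → m ≤ (n : ℤ) - 1 → ∀ f : (S i)⟦m⟧ ⟶ S j, f = 0
  eq_top : ∀ X : C,
    starProduct (fun j : ℕ => (extClosure (ObjectProperty.ofObj S)).shift (j : ℤ)) n X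

/-- The Verdier quotient `C / P`: the localization of `C` at the morphisms with cone in `P`. -/
abbrev VerdierQuotient (P : ObjectProperty C) : Type _ := P.trW.Localization

end Triangulated

end NegCluster

/-! Say that `X` has amplitude `[0, d]` if it receives no nonzero map from `Σ^{>0}S` and has none to
`Σ^{<-d}S`. Truncating by the two co-t-structures discards only perfect pieces, so every object of
the quotient comes from one of amplitude `[0, d]` (`exists_iso_obj`). Between such objects `Q` is
full (`map_surjective`): a perfect cone can be truncated until the obstruction to lifting a fraction
vanishes by duality.

Fullness alone suffices; faithfulness is never needed. It transfers Hom-finiteness, local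
endomorphism rings and the vanishing of Homs between simples, while `dim End(Sᵢ) = 1` survives
because `Sᵢ` is not perfect, hence nonzero in the quotient.

Generation is proved in `T`. Every object is an iterated extension of shifted simples
(`exists_word`), and peeling off the lowest shift repeatedly sorts the factors of an object of
amplitude `[0, d]` into `⟨S⟩ * ⋯ * Σ⁻ᵈ⟨S⟩` (`starProduct_of_orthogonal`). The exact functor `Q`
carries this to the quotient. -/

namespace NegCluster

open ZeroObject

set_option linter.unusedSectionVars false

/-! ### Vanishing of Homs under shifts and retracts. -/

section HomVanishing

variable {C : Type*} [Category* C] [Preadditive C] [HasShift C ℤ]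

/-- Every morphism from `X` to `Y` is zero. -/
def HomZero (X Y : C) : Prop := ∀ f : X ⟶ Y, f = 0

lemma HomZero.of_iso {X Y X' Y' : C} (h : HomZero X Y) (e : X ≅ X') (e' : Y ≅ Y') :
    HomZero X' Y' := fun f => by
  have := h (e.hom ≫ f ≫ e'.inv)
  rw [← cancel_epi e.hom, ← cancel_mono e'.inv]
  simpa using this

lemma leftOrthogonal_of_retract {P : ObjectProperty C} {X Y : C} (r : Retract X Y)
    (h : P.leftOrthogonal Y) : P.leftOrthogonal X := fun Z f hZ => by
  rw [← Category.id_comp f, ← r.retract, Category.assoc, h (r.r ≫ f) hZ, comp_zero]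

lemma rightOrthogonal_of_retract {P : ObjectProperty C} {X Y : C} (r : Retract X Y)
    (h : P.rightOrthogonal Y) : P.rightOrthogonal X := fun Z f hZ => by
  rw [← Category.comp_id f, ← r.retract, ← Category.assoc, h (f ≫ r.i) hZ, zero_comp]

variable {ι : Type*} (S : ι → C)

lemma shifts_of_iso {I : Set ℤ} {X Y : C} (e : X ≅ Y) (h : shifts S I X) : shifts S I Y := by
  obtain ⟨i, n, hn, ⟨e'⟩⟩ := h
  exact ⟨i, n, hn, ⟨e.symm ≪≫ e'⟩⟩

instance (I : Set ℤ) : (shifts S I).IsClosedUnderIsomorphisms where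
  of_iso e h := shifts_of_iso S e h

lemma shifts_shift {I J : Set ℤ} {X : C} (a : ℤ) (h : shifts S I X)
    (hI : ∀ n ∈ I, n + a ∈ J) : shifts S J (X⟦a⟧) := by
  obtain ⟨i, n, hn, ⟨e⟩⟩ := h
  exact ⟨i, n + a, hI n hn,
    ⟨(shiftFunctor C a).mapIso e ≪≫ (shiftFunctorAdd C n a).symm.app (S i)⟩⟩

variable [∀ n : ℤ, (shiftFunctor C n).Additive]

lemma homZero_shift_iff (X Y : C) (a : ℤ) : HomZero (X⟦a⟧) (Y⟦a⟧) ↔ HomZero X Y := by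
  constructor
  · intro h f
    exact (shiftFunctor C a).map_injective (by rw [h (f⟦a⟧'), Functor.map_zero])
  · intro h f
    obtain ⟨g, rfl⟩ := (shiftFunctor C a).map_surjective f
    rw [h g, Functor.map_zero]

lemma homZero_shift_left_iff (X Y : C) (a b : ℤ) (hab : a + b = 0) :
    HomZero (X⟦a⟧) Y ↔ HomZero X (Y⟦b⟧) := by
  rw [← homZero_shift_iff _ _ b]
  exact ⟨fun h => h.of_iso ((shiftFunctorCompIsoId C a b hab).app X) (Iso.refl _),
    fun h => h.of_iso ((shiftFunctorCompIsoId C a b hab).app X).symm (Iso.refl _)⟩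

lemma homZero_shift_shift_iff (X Y : C) (a b c : ℤ) (h : c + a = b) :
    HomZero (X⟦a⟧) (Y⟦b⟧) ↔ HomZero X (Y⟦c⟧) := by
  rw [← homZero_shift_iff X _ a]
  exact ⟨fun h' => h'.of_iso (Iso.refl _) ((shiftFunctorAdd' C c a b h).app Y),
    fun h' => h'.of_iso (Iso.refl _) ((shiftFunctorAdd' C c a b h).app Y).symm⟩

lemma leftOrthogonal_shifts_iff (I : Set ℤ) (X : C) :
    (shifts S I).leftOrthogonal X ↔ ∀ i, ∀ n ∈ I, HomZero X ((S i)⟦n⟧) := by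
  constructor
  · intro h i n hn f
    exact h f ⟨i, n, hn, ⟨Iso.refl _⟩⟩
  · rintro h Y f ⟨i, n, hn, ⟨e⟩⟩
    exact (h i n hn).of_iso (Iso.refl _) e.symm f

lemma rightOrthogonal_shifts_iff (I : Set ℤ) (X : C) :
    (shifts S I).rightOrthogonal X ↔ ∀ i, ∀ n ∈ I, HomZero ((S i)⟦n⟧) X := by
  constructor
  · intro h i n hn f
    exact h f ⟨i, n, hn, ⟨Iso.refl _⟩⟩
  · rintro h Y f ⟨i, n, hn, ⟨e⟩⟩
    exact (h i n hn).of_iso e.symm (Iso.refl _) f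

lemma leftOrthogonal_shifts_shift {I J : Set ℤ} {X : C} (a : ℤ)
    (h : (shifts S I).leftOrthogonal X) (hJ : ∀ n ∈ J, n - a ∈ I) :
    (shifts S J).leftOrthogonal (X⟦a⟧) := by
  rw [leftOrthogonal_shifts_iff] at h ⊢
  intro i n hn
  rw [homZero_shift_shift_iff _ _ a n (n - a) (by ring)]
  exact h i _ (hJ n hn)

lemma rightOrthogonal_shifts_shift {I J : Set ℤ} {X : C} (a : ℤ)
    (h : (shifts S I).rightOrthogonal X) (hJ : ∀ n ∈ J, n - a ∈ I) :
    (shifts S J).rightOrthogonal (X⟦a⟧) := by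
  rw [rightOrthogonal_shifts_iff] at h ⊢
  intro i n hn
  have e : (S i)⟦n⟧ ≅ ((S i)⟦n - a⟧)⟦a⟧ :=
    (shiftFunctorAdd' C (n - a) a n (by ring)).app (S i)
  exact ((homZero_shift_iff _ _ a).2 (h i _ (hJ n hn))).of_iso e.symm (Iso.refl _)

end HomVanishing

/-! ### Lifting, extension and comparison along triangles. -/

section Triangles

variable {C : Type*} [Category* C] [Preadditive C] [HasZeroObject C] [HasShift C ℤ]
  [∀ n : ℤ, (shiftFunctor C n).Additive] [Pretriangulated C]
  {X Y Z : C} {f : X ⟶ Y} {g : Y ⟶ Z} {h : Z ⟶ X⟦(1 : ℤ)⟧}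

lemma exists_desc (hT : Triangle.mk f g h ∈ distTriang C) {W : C} (p : Y ⟶ W)
    (hp : f ≫ p = 0) : ∃ q : Z ⟶ W, g ≫ q = p := by
  obtain ⟨q, hq⟩ := Triangle.yoneda_exact₂ _ hT p hp
  exact ⟨q, hq.symm⟩

lemma exists_lift (hT : Triangle.mk f g h ∈ distTriang C) {W : C} (p : W ⟶ Y)
    (hp : p ≫ g = 0) : ∃ q : W ⟶ X, q ≫ f = p := by
  obtain ⟨q, hq⟩ := Triangle.coyoneda_exact₂ _ hT p hp
  exact ⟨q, hq.symm⟩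

lemma exists_invRotate (hT : Triangle.mk f g h ∈ distTriang C) :
    ∃ (s : Z⟦(-1 : ℤ)⟧ ⟶ X) (w : Y ⟶ (Z⟦(-1 : ℤ)⟧)⟦(1 : ℤ)⟧),
      Triangle.mk s f w ∈ distTriang C :=
  ⟨_, _, inv_rot_of_distTriang _ hT⟩

/-- A morphism out of the first object extends to the second one if the third object, shifted
back, has no nonzero morphism to its target. -/
lemma exists_extension (hT : Triangle.mk f g h ∈ distTriang C) {W : C}
    (hW : HomZero (Z⟦(-1 : ℤ)⟧) W) (p : X ⟶ W) : ∃ q : Y ⟶ W, f ≫ q = p := by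
  obtain ⟨s, w, hs⟩ := exists_invRotate hT
  exact exists_desc hs p (hW _)

lemma nonempty_iso_of_distinguished {X' Z' : C} {f' : X' ⟶ Y} {g' : Y ⟶ Z'}
    {h' : Z' ⟶ X'⟦(1 : ℤ)⟧} (hT : Triangle.mk f g h ∈ distTriang C)
    (hT' : Triangle.mk f' g' h' ∈ distTriang C) (p : Z ⟶ Z') [IsIso p] (hp : g ≫ p = g') :
    Nonempty (X ≅ X') := by
  have comm : (Triangle.mk f g h).mor₂ ≫ p = 𝟙 Y ≫ (Triangle.mk f' g' h').mor₂ :=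
    hp.trans (Category.id_comp _).symm
  obtain ⟨c, hc1, hc2⟩ := complete_distinguished_triangle_morphism₁ _ _ hT hT' (𝟙 Y) p comm
  let φ : Triangle.mk f g h ⟶ Triangle.mk f' g' h' :=
    Triangle.homMk _ _ c (𝟙 Y) p hc1 comm hc2
  have : IsIso c := isIso₁_of_isIso₂₃ φ hT hT' (inferInstanceAs (IsIso (𝟙 Y)))
    (inferInstanceAs (IsIso p))
  exact ⟨@asIso _ _ _ _ c this⟩

/-- The first objects of the triangles on `Y ⟶ Z` and `Y' ⟶ Y ⟶ Z` are compatible with retracts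
`Y` of `Y'`. -/
lemma nonempty_retract_of_distinguished {X' Y' : C} {f' : X' ⟶ Y'} {g' : Y' ⟶ Z}
    {h' : Z ⟶ X'⟦(1 : ℤ)⟧} (hT : Triangle.mk f g h ∈ distTriang C)
    (hT' : Triangle.mk f' g' h' ∈ distTriang C) (r : Retract Y Y') (hr : r.r ≫ g = g') :
    Nonempty (Retract X X') := by
  have hi : r.i ≫ g' = g := by rw [← hr, r.retract_assoc]
  have comm : (Triangle.mk f g h).mor₂ ≫ 𝟙 Z = r.i ≫ (Triangle.mk f' g' h').mor₂ :=
    (Category.comp_id _).trans hi.symm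
  have comm' : (Triangle.mk f' g' h').mor₂ ≫ 𝟙 Z = r.r ≫ (Triangle.mk f g h).mor₂ :=
    (Category.comp_id _).trans hr.symm
  obtain ⟨c, hc1, hc2⟩ := complete_distinguished_triangle_morphism₁ _ _ hT hT' r.i (𝟙 Z) comm
  obtain ⟨c', hc1', hc2'⟩ :=
    complete_distinguished_triangle_morphism₁ _ _ hT' hT r.r (𝟙 Z) comm'
  let φ : Triangle.mk f g h ⟶ Triangle.mk f' g' h' :=
    Triangle.homMk _ _ c r.i (𝟙 Z) hc1 comm hc2
  let ψ : Triangle.mk f' g' h' ⟶ Triangle.mk f g h :=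
    Triangle.homMk _ _ c' r.r (𝟙 Z) hc1' comm' hc2'
  have h2 : (φ ≫ ψ).hom₂ = 𝟙 Y := r.retract
  have h3 : (φ ≫ ψ).hom₃ = 𝟙 Z := Category.comp_id (𝟙 Z)
  have : IsIso (φ ≫ ψ).hom₁ := isIso₁_of_isIso₂₃ _ hT hT
    (by rw [h2]; exact inferInstanceAs (IsIso (𝟙 Y)))
    (by rw [h3]; exact inferInstanceAs (IsIso (𝟙 Z)))
  have hcc : IsIso (c ≫ c') := this
  exact ⟨⟨c, c' ≫ @inv _ _ _ _ (c ≫ c') hcc,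
    (Category.assoc _ _ _).symm.trans (@IsIso.hom_inv_id _ _ _ _ (c ≫ c') hcc)⟩⟩

end Triangles

/-! ### Calculus of `*`-products and extension closures. -/

section Products

variable {C : Type*} [Category* C] [Preadditive C] [HasZeroObject C] [HasShift C ℤ]
  [∀ n : ℤ, (shiftFunctor C n).Additive] [Pretriangulated C]

lemma starProduct_of_iso (A : ℕ → ObjectProperty C) (n : ℕ) {X Y : C} (e : X ≅ Y)
    (h : starProduct A n X) : starProduct A n Y := by
  cases n with
  | zero => exact IsZero.of_iso h e.symm
  | succ n => exact ObjectProperty.prop_of_iso (ObjectProperty.extensionProduct _ _) e h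

instance (A : ℕ → ObjectProperty C) (n : ℕ) :
    (starProduct A n).IsClosedUnderIsomorphisms where
  of_iso e h := starProduct_of_iso A n e h

lemma starProduct_mono {A B : ℕ → ObjectProperty C} (h : ∀ n, A n ≤ B n) (n : ℕ) :
    starProduct A n ≤ starProduct B n := by
  induction n with
  | zero => exact le_refl _
  | succ n hn =>
    exact (ObjectProperty.monotone_extensionProduct_left _ hn).trans
      (ObjectProperty.monotone_extensionProduct_right _ (h n))

lemma starProduct_le_of_le (A : ℕ → ObjectProperty C) [∀ n, (A n).ContainsZero] {m n : ℕ}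
    (h : m ≤ n) : starProduct A m ≤ starProduct A n := by
  induction n, h using Nat.le_induction with
  | base => exact le_refl _
  | succ n _ ih => exact ih.trans (ObjectProperty.le_extensionProduct_left _)

lemma extensionProduct_of_isZero_right {P : ObjectProperty C} [P.IsClosedUnderIsomorphisms]
    {X Y Z : C} {f : X ⟶ Y} {g : Y ⟶ Z} {h : Z ⟶ X⟦(1 : ℤ)⟧}
    (hT : Triangle.mk f g h ∈ distTriang C) (hX : P X) (hZ : IsZero Z) : P Y := by
  have : IsIso f := (Triangle.isZero₃_iff_isIso₁ _ hT).1 hZ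
  exact P.prop_of_iso (asIso f) hX

lemma starProduct_const_add [IsTriangulated C] (P : ObjectProperty C) (m n : ℕ) :
    ObjectProperty.extensionProduct (starProduct (fun _ => P) m) (starProduct (fun _ => P) n) ≤
      starProduct (fun _ => P) (m + n) := by
  induction n with
  | zero =>
    rintro Y ⟨X, Z, f, g, h, hT, hX, hZ⟩
    exact extensionProduct_of_isZero_right hT hX hZ
  | succ n ih =>
    change ObjectProperty.extensionProduct _ (ObjectProperty.extensionProduct _ _) ≤ _
    rw [← ObjectProperty.extensionProduct_assoc]
    exact ObjectProperty.monotone_extensionProduct_left _ ih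

lemma starProduct_const_shift {P P' : ObjectProperty C} (a : ℤ) (h : ∀ X, P X → P' (X⟦a⟧))
    (n : ℕ) {X : C} (hX : starProduct (fun _ => P) n X) :
    starProduct (fun _ => P') n (X⟦a⟧) := by
  induction n generalizing X with
  | zero => exact (shiftFunctor C a).map_isZero hX
  | succ n ih =>
    obtain ⟨Y, Z, f, g, w, hT, hY, hZ⟩ := hX
    exact ⟨_, _, _, _, _, Triangle.shift_distinguished _ hT a, ih hY, h _ hZ⟩

lemma starProduct_const_le (P Q : ObjectProperty C) [Q.IsTriangulatedClosed₂]
    [Q.IsClosedUnderIsomorphisms] [Q.ContainsZero] (h : P ≤ Q) (n : ℕ) :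
    starProduct (fun _ => P) n ≤ Q := by
  induction n with
  | zero => exact fun X hX => ObjectProperty.prop_of_isZero _ hX
  | succ n ih => exact ObjectProperty.extensionProduct_le_of_isTriangulatedClosed₂ ih h

lemma extClosure_of_iso (P : ObjectProperty C) {X Y : C} (e : X ≅ Y) (h : extClosure P X) :
    extClosure P Y :=
  .ext X Y 0 e.hom 0 0 ((Triangle.distinguished_iff_of_isZero₃ _ (isZero_zero C)).2
    (inferInstanceAs (IsIso e.hom)))
    h (.zero _ (isZero_zero _))

instance (P : ObjectProperty C) : (extClosure P).IsClosedUnderIsomorphisms where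
  of_iso e h := extClosure_of_iso P e h

instance (P : ObjectProperty C) : (extClosure P).ContainsZero where
  exists_zero := ⟨0, isZero_zero _, .zero _ (isZero_zero _)⟩

instance (P : ObjectProperty C) : (extClosure P).IsTriangulatedClosed₂ :=
  .mk' fun T hT h₁ h₃ => .ext _ _ _ T.mor₁ T.mor₂ T.mor₃ hT h₁ h₃

instance (P : ObjectProperty C) [P.ContainsZero] [P.IsClosedUnderIsomorphisms] (a : ℤ) :
    (P.shift a).ContainsZero where
  exists_zero := by
    obtain ⟨Z, hZ, hP⟩ := P.exists_prop_of_containsZero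
    exact ⟨Z⟦-a⟧, (shiftFunctor C _).map_isZero hZ,
      P.prop_of_isZero ((shiftFunctor C a).map_isZero ((shiftFunctor C _).map_isZero hZ))⟩

instance (P : ObjectProperty C) [P.IsTriangulatedClosed₂] [P.IsClosedUnderIsomorphisms] (a : ℤ) :
    (P.shift a).IsTriangulatedClosed₂ :=
  .mk' fun _ hT h₁ h₃ =>
    P.ext_of_isTriangulatedClosed₂ _ (Triangle.shift_distinguished _ hT a) h₁ h₃

end Products

/-! ### Words in shifted simples: cancellation, summands, sorting. -/

section SimpleMinded

variable {C : Type*} [Category* C] [Preadditive C] [HasZeroObject C] [HasShift C ℤ]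
  [∀ n : ℤ, (shiftFunctor C n).Additive] [Pretriangulated C]
  {k : Type*} [Field k] [Linear k C] {ι : Type*} {S : ι → C}

lemma IsSMC.homZero (hS : IsSMC k S) {I J : Set ℤ} (hIJ : ∀ n ∈ I, ∀ m ∈ J, m < n)
    {X Y : C} (hX : shifts S I X) (hY : shifts S J Y) : HomZero X Y := by
  obtain ⟨i, n, hn, ⟨e⟩⟩ := hX
  obtain ⟨j, m, hm, ⟨e'⟩⟩ := hY
  refine HomZero.of_iso ?_ e.symm e'.symm
  rw [homZero_shift_shift_iff _ _ n m (m - n) (by ring)]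
  exact hS.hom_neg_shift i j _ (by have := hIJ n hn m hm; omega)

lemma IsSMC.id_ne_zero (hS : IsSMC k S) (i : ι) : 𝟙 (S i) ≠ 0 := by
  intro h
  have : Subsingleton (S i ⟶ S i) := ⟨fun f g => by
    rw [← Category.id_comp f, ← Category.id_comp g, h, zero_comp, zero_comp]⟩
  have := hS.finrank_self i
  rw [Module.finrank_zero_of_subsingleton] at this
  exact zero_ne_one this

lemma IsSMC.not_isZero (hS : IsSMC k S) {I : Set ℤ} {X : C} (hX : shifts S I X) :
    ¬ IsZero X := by
  obtain ⟨i, n, -, ⟨e⟩⟩ := hX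
  intro h
  have h' : IsZero ((S i)⟦n⟧) := h.of_iso e.symm
  exact hS.id_ne_zero i ((shiftFunctor C n).map_injective (h'.eq_of_src _ _))

lemma IsSMC.isIso_of_ne_zero (hS : IsSMC k S) (hF : IsHomFinite k C) {a : ℤ} {X Y : C}
    (hX : shifts S {a} X) (hY : shifts S {a} Y) (f : X ⟶ Y) (hf : f ≠ 0) : IsIso f := by
  obtain ⟨i, n, rfl, ⟨e⟩⟩ := hX
  obtain ⟨j, m, rfl, ⟨e'⟩⟩ := hY
  obtain ⟨g, hg⟩ := (shiftFunctor C m).map_surjective (e.inv ≫ f ≫ e'.hom)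
  have hfg : f = e.hom ≫ g⟦m⟧' ≫ e'.inv := by simp [hg]
  have hg0 : g ≠ 0 := by
    rintro rfl
    exact hf (by simp [hfg])
  have := hF (S i) (S j)
  have hij : i = j := by
    by_contra hij
    have := Module.finrank_zero_iff.1 (hS.finrank_of_ne i j hij)
    exact hg0 (Subsingleton.elim _ _)
  subst hij
  obtain ⟨c, rfl⟩ := (finrank_eq_one_iff_of_nonzero' _ (hS.id_ne_zero i)).1
    (hS.finrank_self i) g
  have hc : c ≠ 0 := by
    rintro rfl
    exact hg0 (zero_smul _ _)
  have : IsIso (c • 𝟙 (S i)) := ⟨c⁻¹ • 𝟙 (S i), by simp [smul_smul, hc], by simp [smul_smul, hc]⟩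
  rw [hfg]
  infer_instance

/-- The `n`-fold extensions of shifts `Σᵐ Sᵢ` with `m ∈ I`. -/
abbrev word (S : ι → C) (I : Set ℤ) (n : ℕ) : ObjectProperty C :=
  starProduct (fun _ => shifts S I) n

lemma shifts_mono {I J : Set ℤ} (h : I ⊆ J) : shifts S I ≤ shifts S J :=
  fun _ ⟨i, n, hn, e⟩ => ⟨i, n, h hn, e⟩

lemma word_mono {I J : Set ℤ} (h : I ⊆ J) (n : ℕ) : word S I n ≤ word S J n :=
  starProduct_mono (fun _ => shifts_mono h) n

lemma IsSMC.homZero_word (hS : IsSMC k S) {I J : Set ℤ} (hIJ : ∀ n ∈ I, ∀ m ∈ J, m < n)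
    {n : ℕ} {X Y : C} (hX : word S I n X) (hY : shifts S J Y) : HomZero X Y := by
  have := starProduct_const_le (shifts S I) (shifts S J).leftOrthogonal
    (fun X hX Y f hY => hS.homZero hIJ hX hY f) n X hX
  exact fun f => this f hY

/-- A third object of the triangle on a nonzero morphism to `Σᵃ Sᵢ` from an extension of shifts
`Σᵐ Sⱼ` with `m ≥ a` is a shorter extension of the same kind. -/
lemma IsSMC.word_cocone [IsTriangulated C] (hS : IsSMC k S) (hF : IsHomFinite k C) {a : ℤ}
    {n : ℕ} {W' W Z : C} {v : W' ⟶ W} {g : W ⟶ Z} {w : Z ⟶ W'⟦(1 : ℤ)⟧}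
    (hT : Triangle.mk v g w ∈ distTriang C) (hW : word S (Set.Ici a) n W)
    (hZ : shifts S {a} Z) (hg : g ≠ 0) : ∃ m, n = m + 1 ∧ word S (Set.Ici a) m W' := by
  induction n generalizing W' W with
  | zero => exact (hg (IsZero.eq_of_src hW _ _)).elim
  | succ n ih =>
    obtain ⟨V, B, u, b, δ, hT', hV, hB⟩ := hW
    -- If `g` kills `V`, it factors through `B` by a nonzero map; Hom-vanishing puts `B` in degree
    -- `a`, Schur makes the map invertible, and `W' ≅ V`. Otherwise the octahedron gives `V' ⟶ W' ⟶
    -- B`, with `V'` the cocone of `V ⟶ Z`, and induction applies to `V'`.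
    by_cases hug : u ≫ g = 0
    · refine ⟨n, rfl, ?_⟩
      obtain ⟨h, hh⟩ := exists_desc hT' g hug
      have hh0 : h ≠ 0 := by
        rintro rfl
        exact hg (by simp [← hh])
      have hBa : shifts S {a} B := by
        obtain ⟨j, m, hm, e⟩ := hB
        rcases eq_or_lt_of_le (Set.mem_Ici.1 hm) with rfl | hlt
        · exact ⟨j, a, rfl, e⟩
        · exact (hh0 (hS.homZero (I := {m}) (J := {a}) (by simpa using hlt)
            ⟨j, m, rfl, e⟩ hZ h)).elim
      have := hS.isIso_of_ne_zero hF hBa hZ h hh0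
      obtain ⟨e⟩ := nonempty_iso_of_distinguished hT' hT h hh
      exact ObjectProperty.prop_of_iso _ e hV
    · obtain ⟨V', v', w', hV'⟩ := distinguished_cocone_triangle₁ (u ≫ g)
      obtain ⟨m, rfl, hm⟩ := ih hV' hV hug
      obtain ⟨s, w'', hs⟩ := exists_invRotate hT'
      have o := Triangulated.someOctahedron' rfl hs hT hV'
      refine ⟨m + 1, rfl, _, _, _, _, _, rot_of_distTriang _ o.mem, hm, ?_⟩
      exact shifts_of_iso S ((shiftFunctorCompIsoId C (-1 : ℤ) 1 (by simp)).app B).symm hB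

/-- A nonzero extension of shifts of the `Sᵢ` has a nonzero morphism to the lowest shift that is
needed to build it. -/
lemma IsSMC.exists_lowest [IsTriangulated C] (hS : IsSMC k S) (hF : IsHomFinite k C) {I : Set ℤ}
    {n : ℕ} {W : C} (hW : word S I n W) : IsZero W ∨ ∃ (a : ℤ) (Z : C) (g : W ⟶ Z) (m : ℕ),
      m ≤ n ∧ shifts S {a} Z ∧ g ≠ 0 ∧ word S (Set.Ici a) m W := by
  replace hW := word_mono (Set.subset_univ I) n W hW
  induction n using Nat.strong_induction_on generalizing W with
  | _ n ih =>
  cases n with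
  | zero => exact Or.inl hW
  | succ n =>
    obtain ⟨V, B, u, b, δ, hT, hV, j, c, -, ⟨e⟩⟩ := hW
    have hB : shifts S {c} B := ⟨j, c, rfl, ⟨e⟩⟩
    have key : ∀ m ≤ n, word S (Set.Ici c) m V → ∃ (a : ℤ) (Z : C) (g : W ⟶ Z) (m : ℕ),
        m ≤ n + 1 ∧ shifts S {a} Z ∧ g ≠ 0 ∧ word S (Set.Ici a) m W := by
      intro m hm hVm
      refine ⟨c, B, b, m + 1, by omega, hB, ?_, V, B, u, b, δ, hT, hVm,
        shifts_mono (by simp) _ hB⟩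
      -- If `b = 0`, then `𝟙 B` factors through `V⟦1⟧`, whose factors have shift at least `c + 1`,
      -- so it vanishes.
      rintro rfl
      obtain ⟨r, hr⟩ := exists_desc (rot_of_distTriang _ hT) (𝟙 B) zero_comp
      have : r = 0 := hS.homZero_word (I := Set.Ici (c + 1)) (J := {c})
        (by simp) (starProduct_const_shift 1
          (fun X hX => shifts_shift S 1 hX (by simp)) m hVm) hB r
      refine hS.not_isZero hB ((IsZero.iff_id_eq_zero _).2 ?_)
      rw [← hr, this]
      exact comp_zero
    obtain hV0 | ⟨a, Z, z, m, hm, hZ, hz, hVm⟩ := ih n (by omega) hV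
    · exact Or.inr <| key 0 (by omega) hV0
    · obtain hca | hca := le_or_gt c a
      · exact Or.inr <| key m hm (word_mono (Set.Ici_subset_Ici.2 hca) m V hVm)
      · by_cases hq : ∃ q : W ⟶ Z, u ≫ q = z
        · obtain ⟨q, rfl⟩ := hq
          refine Or.inr ⟨a, Z, q, m + 1, by omega, hZ, ?_, V, B, u, b, δ, hT, hVm,
            shifts_mono (by simp; omega) _ hB⟩
          rintro rfl
          exact hz comp_zero
        · obtain ⟨s, w, hs⟩ := exists_invRotate hT
          have hsz : s ≫ z ≠ 0 := fun h => hq (exists_desc hs z h)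
          have hB' : shifts S {c - 1} (B⟦(-1 : ℤ)⟧) := shifts_shift S (-1) hB (by simp; omega)
          have hca' : c - 1 = a := by
            by_contra hne
            exact hsz (hS.homZero (I := {c - 1}) (J := {a}) (by simp; omega) hB' hZ _)
          subst hca'
          have hiso := hS.isIso_of_ne_zero hF hB' hZ _ hsz
          obtain ⟨V', v, w', hV'⟩ := distinguished_cocone_triangle₁ z
          obtain ⟨m', rfl, hm'⟩ := hS.word_cocone hF hV' hVm hZ hz
          have hZ0 : Triangle.mk (s ≫ z) (0 : Z ⟶ 0) 0 ∈ distTriang C :=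
            (Triangle.distinguished_iff_of_isZero₃ _ (isZero_zero C)).2 hiso
          have o := Triangulated.someOctahedron rfl hs (rot_of_distTriang _ hV') hZ0
          have := (Triangle.isZero₂_iff_isIso₃ _ o.mem).1 (isZero_zero C)
          let i : V'⟦(1 : ℤ)⟧ ≅ W⟦(1 : ℤ)⟧ := @asIso _ _ _ _ _ this
          have hW' : word S (Set.Ici (c - 1)) m' W :=
            ObjectProperty.prop_of_iso _ ((shiftFunctor C (1 : ℤ)).preimageIso i) hm'
          obtain hW0 | ⟨a', Z', g, l, hl, h⟩ :=
            ih m' (by omega) (word_mono (Set.subset_univ _) m' W hW')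
          · exact Or.inl hW0
          · exact Or.inr ⟨a', Z', g, l, by omega, h⟩


lemma IsSMC.word_of_retract [IsTriangulated C] (hS : IsSMC k S) (hF : IsHomFinite k C) {n : ℕ}
    {X W : C} (r : Retract X W) (hW : word S Set.univ n W) : ∃ m, word S Set.univ m X := by
  induction n using Nat.strong_induction_on generalizing X W with
  | _ n ih =>
  obtain hW0 | ⟨a, Z, g, m, hm, hZ, hg, hWa⟩ := hS.exists_lowest hF hW
  · refine ⟨0, (IsZero.iff_id_eq_zero _).2 ?_⟩
    rw [← r.retract, hW0.eq_of_tgt r.i 0, zero_comp]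
  · by_cases hig : r.i ≫ g = 0
    · obtain ⟨W', v, w, hT⟩ := distinguished_cocone_triangle₁ g
      obtain ⟨m, rfl, hW'⟩ := hS.word_cocone hF hT hWa hZ hg
      obtain ⟨l, hl⟩ := exists_lift hT r.i hig
      exact ih m (by omega) ⟨l, v ≫ r.r, by rw [reassoc_of% hl, r.retract]⟩
        (word_mono (Set.subset_univ _) m W' hW')
    · obtain ⟨W', v, w, hT⟩ := distinguished_cocone_triangle₁ (r.r ≫ r.i ≫ g)
      obtain ⟨X', v', w', hT'⟩ := distinguished_cocone_triangle₁ (r.i ≫ g)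
      obtain ⟨m, rfl, hW'⟩ := hS.word_cocone hF hT hWa hZ (fun h => hig (by
        rw [← r.retract_assoc (r.i ≫ g), h, comp_zero]))
      obtain ⟨r'⟩ := nonempty_retract_of_distinguished hT' hT r rfl
      obtain ⟨l, hl⟩ := ih m (by omega) r' (word_mono (Set.subset_univ _) m W' hW')
      exact ⟨l + 1, X', Z, v', _, w', hT', hl, shifts_mono (Set.subset_univ _) _ hZ⟩

/-- Every object is an iterated extension of shifts of the `Sᵢ`. -/
lemma IsSMC.exists_word [IsTriangulated C] (hS : IsSMC k S) (hF : IsHomFinite k C) (X : C) :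
    ∃ n, word S Set.univ n X := by
  let E : ObjectProperty C := fun X => ∃ n, word S Set.univ n X
  have : E.IsClosedUnderIsomorphisms :=
    ⟨fun e ⟨n, hn⟩ => ⟨n, ObjectProperty.prop_of_iso _ e hn⟩⟩
  have hE : E.IsTriangulated :=
    { exists_zero := ⟨0, isZero_zero C, 0, isZero_zero C⟩
      isStableUnderShiftBy := fun a => ⟨fun X ⟨n, hn⟩ =>
        ⟨n, starProduct_const_shift a (fun Y hY => shifts_shift S a hY (by simp)) n hn⟩⟩
      toIsTriangulatedClosed₂ := .mk' fun T hT ⟨m, hm⟩ ⟨n, hn⟩ =>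
        ⟨m + n, starProduct_const_add _ m n _ ⟨_, _, _, _, _, hT, hm, hn⟩⟩ }
  exact hS.thick_eq_top E hE ⟨fun r ⟨_, hn⟩ => hS.word_of_retract hF r hn⟩
    (fun i => ⟨1, 0, S i, 0, 𝟙 _, 0, contractible_distinguished₁ _, isZero_zero C,
      i, 0, trivial, ⟨((shiftFunctorZero C ℤ).app (S i)).symm⟩⟩) X

/-- The factors `Σ⁻ʲ⟨S⟩`. -/
abbrev heartShift (S : ι → C) (j : ℕ) : ObjectProperty C :=
  (extClosure (ObjectProperty.ofObj S)).shift (j : ℤ)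

lemma heartShift_of_shifts {j : ℕ} {X : C} (h : shifts S {-(j : ℤ)} X) : heartShift S j X := by
  obtain ⟨i, n, rfl, ⟨e⟩⟩ := h
  exact extClosure_of_iso _ (((shiftFunctor C (j : ℤ)).mapIso e ≪≫
    (shiftFunctorCompIsoId C (-(j : ℤ)) j (by simp)).app (S i))).symm (.of _ ⟨i⟩)

lemma starProduct_extension_last [IsTriangulated C] (A : ℕ → ObjectProperty C) (n : ℕ)
    [(A n).IsTriangulatedClosed₂] [(A n).IsClosedUnderIsomorphisms] {X Y Z : C}
    {f : X ⟶ Y} {g : Y ⟶ Z} {h : Z ⟶ X⟦(1 : ℤ)⟧} (hT : Triangle.mk f g h ∈ distTriang C)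
    (hX : starProduct A (n + 1) X) (hZ : A n Z) : starProduct A (n + 1) Y := by
  have hY : ObjectProperty.extensionProduct
    (ObjectProperty.extensionProduct (starProduct A n) (A n)) (A n) Y :=
    ⟨_, _, _, _, _, hT, hX, hZ⟩
  rw [ObjectProperty.extensionProduct_assoc] at hY
  exact ObjectProperty.monotone_extensionProduct_right _
    (ObjectProperty.extensionProduct_le_of_isTriangulatedClosed₂ le_rfl le_rfl) _ hY

/-- The lowest shift `Σ⁻ᵇSᵢ` splits off on the right and leaves a shorter word with shifts at least
`-b`. Induction puts the rest in the product ending at `Σ⁻ᵇ⟨S⟩`, whose extension-closed last factor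
absorbs the removed simple. -/
lemma IsSMC.starProduct_of_word [IsTriangulated C] (hS : IsSMC k S) (hF : IsHomFinite k C)
    (n c : ℕ) {X : C} (hX : word S (Set.Ici (-(c : ℤ))) n X)
    (hX' : (shifts S (Set.Ioi 0)).rightOrthogonal X) :
    starProduct (heartShift S) (c + 1) X := by
  induction n using Nat.strong_induction_on generalizing X c with
  | _ n ih =>
  obtain hX0 | ⟨a, Z, g, m, hm, hZ, hg, hXa⟩ := hS.exists_lowest hF hX
  · exact starProduct_le_of_le _ (Nat.zero_le _) _ hX0
  · have ha : -(c : ℤ) ≤ a := by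
      by_contra! hlt
      exact hg (hS.homZero_word (J := {a}) (by simp; omega) hX hZ g)
    have ha' : a ≤ 0 := by
      by_contra! hlt
      -- If `a > 0`, words with shifts at least `a` have no maps to `(Σ^{>0}S)^⊥`. As `X` is both,
      -- `𝟙 X = 0`.
      have h0 := starProduct_const_le (shifts S (Set.Ici a))
        (shifts S (Set.Ioi 0)).rightOrthogonal.leftOrthogonal
        (fun Y hY W f hW => hW f (shifts_mono (fun n hn => lt_of_lt_of_le hlt hn) _ hY))
        m X hXa (𝟙 X) hX'
      exact hg (by rw [← Category.id_comp g, h0, zero_comp])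
    obtain ⟨b, rfl⟩ : ∃ b : ℕ, a = -(b : ℤ) := ⟨a.natAbs, by omega⟩
    obtain ⟨Y, v, w, hT⟩ := distinguished_cocone_triangle₁ g
    obtain ⟨m, rfl, hY⟩ := hS.word_cocone hF hT hXa hZ hg
    have hY' : (shifts S (Set.Ioi 0)).rightOrthogonal Y := by
      have := (shifts S (Set.Ioi 0)).rightOrthogonal.ext_of_isTriangulatedClosed₂ _
        (inv_rot_of_distTriang _ hT) ?_ hX'
      · exact this
      · intro W f hW
        exact hS.homZero (J := {-(b : ℤ) - 1}) (by simp; omega) hW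
          (shifts_shift S (-1) hZ (by simp; omega)) f
    exact starProduct_le_of_le _ (by omega) _ (starProduct_extension_last (heartShift S) b hT
      (ih m (by omega) b hY hY') (heartShift_of_shifts hZ))

/-- The objects of cohomological amplitude `[0, d]` lie in `⟨S⟩ * Σ⁻¹⟨S⟩ * ⋯ * Σ⁻ᵈ⟨S⟩`. -/
lemma IsSMC.starProduct_of_orthogonal [IsTriangulated C] (hS : IsSMC k S)
    (hF : IsHomFinite k C) (d : ℕ) {X : C}
    (hX : (shifts S (Set.Iio (-(d : ℤ)))).leftOrthogonal X)
    (hX' : (shifts S (Set.Ioi 0)).rightOrthogonal X) :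
    starProduct (heartShift S) (d + 1) X := by
  obtain ⟨n, hn⟩ := hS.exists_word hF X
  obtain hX0 | ⟨a, Z, g, m, hm, hZ, hg, hXa⟩ := hS.exists_lowest hF hn
  · exact starProduct_le_of_le _ (Nat.zero_le _) _ hX0
  · refine hS.starProduct_of_word hF m d (word_mono (Set.Ici_subset_Ici.2 ?_) m X hXa) hX'
    by_contra! hlt
    exact hg (hX g (shifts_mono (by simpa using hlt) _ hZ))

end SimpleMinded

/-! ### Transport along triangulated functors. -/

section Functors

variable {C D : Type*} [Category* C] [Preadditive C] [HasZeroObject C] [HasShift C ℤ]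
  [∀ n : ℤ, (shiftFunctor C n).Additive] [Pretriangulated C]
  [Category* D] [Preadditive D] [HasZeroObject D] [HasShift D ℤ]
  [∀ n : ℤ, (shiftFunctor D n).Additive] [Pretriangulated D]
  (F : C ⥤ D) [F.CommShift ℤ] [F.IsTriangulated]

lemma extensionProduct_map {P Q : ObjectProperty C} {P' Q' : ObjectProperty D}
    (hP : P ≤ P'.inverseImage F) (hQ : Q ≤ Q'.inverseImage F) :
    ObjectProperty.extensionProduct P Q ≤
      (ObjectProperty.extensionProduct P' Q').inverseImage F := by
  rintro Y ⟨X, Z, f, g, h, hT, hX, hZ⟩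
  exact ⟨_, _, _, _, _, F.map_distinguished _ hT, hP _ hX, hQ _ hZ⟩

lemma starProduct_map {A : ℕ → ObjectProperty C} {B : ℕ → ObjectProperty D}
    (h : ∀ n, A n ≤ (B n).inverseImage F) (n : ℕ) :
    starProduct A n ≤ (starProduct B n).inverseImage F := by
  induction n with
  | zero => exact fun X hX => F.map_isZero hX
  | succ n ih => exact extensionProduct_map F ih (h n)

lemma extClosure_map {P : ObjectProperty C} {P' : ObjectProperty D}
    (h : P ≤ P'.inverseImage F) : extClosure P ≤ (extClosure P').inverseImage F := by
  intro X hX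
  induction hX with
  | zero X hX => exact .zero _ (F.map_isZero hX)
  | of X hX => exact .of _ (h X hX)
  | ext X Y Z f g w hT _ _ hX hZ => exact .ext _ _ _ _ _ _ (F.map_distinguished _ hT) hX hZ

lemma heartShift_map {ι : Type*} (S : ι → C) (j : ℕ) :
    heartShift S j ≤ (heartShift (fun i => F.obj (S i)) j).inverseImage F := by
  intro X hX
  refine extClosure_of_iso _ ((F.commShiftIso (j : ℤ)).app X) (extClosure_map F ?_ _ hX)
  rintro _ ⟨i⟩
  exact ⟨i⟩

end Functors

/-! ### Duality, representatives and fullness of the quotient functor. -/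

section Triple

variable {k : Type*} [Field k] {T : Type*} [Category* T] [Preadditive T] [Linear k T]
  [HasZeroObject T] [HasShift T ℤ] [∀ n : ℤ, (shiftFunctor T n).Additive]
  [Pretriangulated T]
  {P : ObjectProperty T} {ι : Type*} {S : ι → T} {d : ℕ}

lemma RelativeDuality.homZero_iff (D : RelativeDuality k P d) {X Y : T} (hX : P X) :
    HomZero X Y ↔ HomZero Y (X⟦(-(d : ℤ))⟧) := by
  constructor
  · intro h f
    refine (D.iso X Y hX).injective (LinearMap.ext fun u => ?_)
    rw [h u, map_zero, map_zero]
  · intro h f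
    refine (Module.forall_dual_apply_eq_zero_iff k f).1 fun φ => ?_
    obtain ⟨g, rfl⟩ := (D.iso X Y hX).surjective φ
    rw [h g, map_zero, LinearMap.zero_apply]

/-- By duality, `Hom(X, ΣⁿSᵢ)` vanishes exactly when `Hom(Σⁿ⁺ᵈSᵢ, X)` does. -/
lemma IsNegCYTriple.leftOrthogonal_shifts_iff (h : IsNegCYTriple k P S d) {I J : Set ℤ}
    (hIJ : ∀ n : ℤ, n + d ∈ J ↔ n ∈ I) {X : T} (hX : P X) :
    (shifts S I).leftOrthogonal X ↔ (shifts S J).rightOrthogonal X := by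
  obtain ⟨D⟩ := h.duality
  rw [NegCluster.leftOrthogonal_shifts_iff, rightOrthogonal_shifts_iff]
  have key : ∀ i (n : ℤ), HomZero X ((S i)⟦n⟧) ↔ HomZero ((S i)⟦n + (d : ℤ)⟧) X := fun i n => by
    rw [D.homZero_iff hX, ← homZero_shift_left_iff _ _ (d : ℤ) _ (by ring)]
    exact ⟨fun h' => h'.of_iso ((shiftFunctorAdd T n (d : ℤ)).app (S i)).symm (Iso.refl _),
      fun h' => h'.of_iso ((shiftFunctorAdd T n (d : ℤ)).app (S i)) (Iso.refl _)⟩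
  constructor
  · intro H i n hn
    have := (key i (n - d)).1 (H i _ ((hIJ _).1 (by simpa using hn)))
    rwa [sub_add_cancel] at this
  · intro H i n hn
    exact (key i n).2 (H i _ ((hIJ n).2 hn))

/-- The simple minded objects do not lie in the perfect part. -/
lemma IsNegCYTriple.not_prop (h : IsNegCYTriple k P S d) (hd : 1 ≤ d) (i : ι) : ¬ P (S i) := by
  intro hi
  obtain ⟨D⟩ := h.duality
  exact h.smc.id_ne_zero i
    ((D.homZero_iff hi).2 (h.smc.hom_neg_shift i i _ (by omega)) (𝟙 (S i)))

/-- This kills the obstruction in the fullness argument. Duality moves `A` to the left orthogonal of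
`Σ^{≥-d}S`; then `ΣᵈA` and `Σᵈ⁺¹Y` lie in the two halves of the left co-t-structure. -/
lemma IsNegCYTriple.homZero_of_orthogonal (h : IsNegCYTriple k P S d) {A Y : T} (hA : P A)
    (hA' : (shifts S (Set.Ici 0)).rightOrthogonal A)
    (hY : (shifts S (Set.Iio (-(d : ℤ) - 1))).leftOrthogonal Y) :
    HomZero (A⟦(-1 : ℤ)⟧) Y := by
  have h1 : (shifts S (Set.Ici (-(d : ℤ)))).leftOrthogonal A :=
    (h.leftOrthogonal_shifts_iff (by simp; omega) hA).2 hA'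
  have h2 := leftOrthogonal_shifts_shift S (J := Set.Ici 0) (d : ℤ) h1 (by simp)
  have h3 := leftOrthogonal_shifts_shift S (J := Set.Iio 0) ((d : ℤ) + 1) hY (by simp; omega)
  rw [homZero_shift_left_iff _ _ (-1) 1 (by ring),
    ← homZero_shift_shift_iff _ _ (d : ℤ) (d + 1) 1 (by ring)]
  exact fun f => h.coT_left.hom_eq_zero _ _ h2 h3 f

variable [IsTriangulated T] [P.IsTriangulated]

lemma IsNegCYTriple.isClosedUnderIsomorphisms (h : IsNegCYTriple k P S d) :
    P.IsClosedUnderIsomorphisms :=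
  ⟨fun e hX => h.retracts.of_retract ⟨e.inv, e.hom, e.inv_hom_id⟩ hX⟩

/-- The map from `X` to the cone `Z` of the denominator factors through the truncation `A` of `Z`,
since `Hom(X, B) = 0`. Hence the denominator may be replaced by one with cone `A`, and the numerator
then extends to `X` because `Hom(Σ⁻¹A, Y) = 0`. -/
lemma IsNegCYTriple.map_surjective_of_orthogonal (h : IsNegCYTriple k P S d) {X Y : T}
    (hX : (shifts S (Set.Ici 0)).rightOrthogonal X)
    (hY : (shifts S (Set.Iio (-(d : ℤ) - 1))).leftOrthogonal Y) :
    Function.Surjective (P.trW.Q.map : (X ⟶ Y) → _) := by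
  intro f
  have := h.isClosedUnderIsomorphisms
  obtain ⟨φ, hφ⟩ := Localization.exists_rightFraction P.trW.Q P.trW f
  have hf : P.trW.Q.map φ.s ≫ f = P.trW.Q.map φ.f := by
    rw [hφ, MorphismProperty.RightFraction.map_s_comp_map]
  obtain ⟨Z, p, w, hT, hZ⟩ := φ.hs
  obtain ⟨A, B, a, b, c, hT', hA, hB⟩ := h.coT_right.exists_triangle Z
  have hA' : P A := P.ext_of_isTriangulatedClosed₁ _ hT' hZ (h.right_le _ hB)
  obtain ⟨q, hq⟩ := exists_lift hT' p (h.coT_right.hom_eq_zero _ _ hX hB _)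
  obtain ⟨X'', t, w', hT''⟩ := distinguished_cocone_triangle₁ q
  have ht : P.trW t := ⟨_, _, _, hT'', hA'⟩
  obtain ⟨l, hl⟩ := exists_lift hT t (by
    have : t ≫ q = 0 := comp_distTriang_mor_zero₁₂ _ hT''
    rw [← hq, reassoc_of% this, zero_comp])
  obtain ⟨g, hg⟩ := exists_extension hT'' (h.homZero_of_orthogonal hA' hA hY) (l ≫ φ.f)
  refine ⟨g, ?_⟩
  have : IsIso (P.trW.Q.map t) := Localization.inverts P.trW.Q P.trW t ht
  rw [← cancel_epi (P.trW.Q.map t), ← Functor.map_comp, hg, Functor.map_comp, ← hf,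
    ← Functor.map_comp_assoc, hl]

/-- Morphisms in the Verdier quotient lift when the amplitudes of source and target differ by
at most `d`. -/
lemma IsNegCYTriple.map_surjective (h : IsNegCYTriple k P S d) (a : ℤ) {X Y : T}
    (hX : (shifts S (Set.Ioi a)).rightOrthogonal X)
    (hY : (shifts S (Set.Iio (a - d))).leftOrthogonal Y) :
    Function.Surjective (P.trW.Q.map : (X ⟶ Y) → _) := by
  intro f
  -- This shift moves the bound `> a` to `≥ 0` and `< a - d` to `< -d - 1`.
  let b : ℤ := -1 - a
  obtain ⟨g, hg⟩ := h.map_surjective_of_orthogonal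
    (rightOrthogonal_shifts_shift S (J := Set.Ici 0) b hX (by simp [b]; omega))
    (leftOrthogonal_shifts_shift S (J := Set.Iio (-(d : ℤ) - 1)) b hY (by simp [b]; omega))
    ((P.trW.Q.commShiftIso b).hom.app X ≫ f⟦b⟧' ≫ (P.trW.Q.commShiftIso b).inv.app Y)
  obtain ⟨g, rfl⟩ := (shiftFunctor T b).map_surjective g
  refine ⟨g, (shiftFunctor _ b).map_injective ?_⟩
  have := (P.trW.Q.commShiftIso b).hom.naturality g
  dsimp at this
  rw [hg] at this
  simpa using this.symm


/-- Every object of the Verdier quotient comes from an object of amplitude `[0, d]`. -/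
lemma IsNegCYTriple.exists_iso_obj (h : IsNegCYTriple k P S d) (U : VerdierQuotient P) :
    ∃ X : T, (shifts S (Set.Ioi 0)).rightOrthogonal X ∧
      (shifts S (Set.Iio (-(d : ℤ)))).leftOrthogonal X ∧ Nonempty (P.trW.Q.obj X ≅ U) := by
  have := h.isClosedUnderIsomorphisms
  let X := P.trW.Q.objPreimage U
  obtain ⟨A, B, f, g, w, hT, hA, hB⟩ := h.coT_left.exists_triangle (X⟦(d : ℤ)⟧)
  have hg : P.trW (g⟦(-(d : ℤ))⟧') :=
    (ObjectProperty.trW.mk' P hT (h.left_le _ hA)).shift (-(d : ℤ))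
  have hB' : (shifts S (Set.Iio (-(d : ℤ)))).leftOrthogonal (B⟦(-(d : ℤ))⟧) :=
    leftOrthogonal_shifts_shift S _ hB (by simp; omega)
  obtain ⟨A', B', f', g', w', hT', hA', hB''⟩ :=
    h.coT_right.exists_triangle ((B⟦(-(d : ℤ))⟧)⟦(-1 : ℤ)⟧)
  have hf' : P.trW (f'⟦(1 : ℤ)⟧') :=
    (ObjectProperty.trW.mk P hT' (h.right_le _ hB'')).shift 1
  refine ⟨A'⟦(1 : ℤ)⟧, rightOrthogonal_shifts_shift S _ hA' (by simp; omega), ?_, ⟨?_⟩⟩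
  -- The second truncation keeps the lower bound: duality turns `B' ∈ (Σ^{<0}S)^⊥` into
  -- orthogonality to `Σ^{<-d}S`, and the object is an extension of `Σ⁻ᵈB` by `B'`.
  · have hB3 : (shifts S (Set.Iio (-(d : ℤ)))).leftOrthogonal B' :=
      (h.leftOrthogonal_shifts_iff (J := Set.Iio 0) (by simp; omega) (h.right_le _ hB'')).2 hB''
    have hT2 := rot_of_distTriang _ (rot_of_distTriang _ hT')
    exact (shifts S (Set.Iio (-(d : ℤ)))).leftOrthogonal.ext_of_isTriangulatedClosed₂ _ hT2 hB3
      (ObjectProperty.prop_of_iso _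
        ((shiftFunctorCompIsoId T (-1 : ℤ) 1 (by simp)).app (B⟦(-(d : ℤ))⟧)).symm hB')
  · have := Localization.inverts P.trW.Q P.trW _ hg
    have := Localization.inverts P.trW.Q P.trW _ hf'
    exact asIso (P.trW.Q.map (f'⟦(1 : ℤ)⟧')) ≪≫
      P.trW.Q.mapIso ((shiftFunctorCompIsoId T (-1 : ℤ) 1 (by simp)).app _) ≪≫
      (asIso (P.trW.Q.map (g⟦(-(d : ℤ))⟧'))).symm ≪≫
      P.trW.Q.mapIso ((shiftFunctorCompIsoId T (d : ℤ) (-(d : ℤ)) (by simp)).app X) ≪≫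
      P.trW.Q.objObjPreimageIso U

lemma IsNegCYTriple.isHomFinite_quotient (h : IsNegCYTriple k P S d) :
    IsHomFinite k (VerdierQuotient P) := by
  intro U V
  obtain ⟨X, hX, -, ⟨e⟩⟩ := h.exists_iso_obj U
  obtain ⟨Y, -, hY, ⟨e'⟩⟩ := h.exists_iso_obj V
  have := h.homFinite X Y
  have : Module.Finite k (P.trW.Q.obj X ⟶ P.trW.Q.obj Y) :=
    Module.Finite.of_surjective (P.trW.Q.mapLinearMap k)
      (h.map_surjective 0 hX (by simpa using hY))
  exact Module.Finite.equiv (Linear.homCongr k e e')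

end Triple

/-! ### Local endomorphism rings under full functors. -/

section KrullSchmidt

variable {C D : Type*} [Category* C] [Preadditive C] [Category* D] [Preadditive D]

/-- A nonzero quotient of a local ring is local. -/
lemma isLocalRing_of_end_surjective (F : C ⥤ D) [F.Additive] {X : C} (hX : IsLocalRing (End X))
    (hF : Function.Surjective (F.map : (X ⟶ X) → _)) (h0 : ¬ IsZero (F.obj X)) :
    IsLocalRing (End (F.obj X)) := by
  have : Nontrivial (End (F.obj X)) :=
    ⟨𝟙 (F.obj X), 0, fun h => h0 ((IsZero.iff_id_eq_zero _).2 h)⟩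
  let φ : End X →+* End (F.obj X) :=
    { F.mapEnd X with
      map_zero' := F.map_zero X X
      map_add' := fun _ _ => F.map_add }
  refine IsLocalRing.of_isUnit_or_isUnit_one_sub_self fun y => ?_
  obtain ⟨x, rfl⟩ : ∃ x, φ x = y := hF y
  rw [← map_one φ, ← map_sub]
  exact (hX.isUnit_or_isUnit_of_add_one (add_sub_cancel x 1)).imp
    (fun h => h.map φ) (fun h => h.map φ)

/-- An object is a direct sum of objects with local endomorphism ring if it is a direct sum of
objects each of which is zero or has a local endomorphism ring. -/
lemma exists_local_decomposition {n : ℕ} {f : Fin n → C} (b : Bicone f) (hb : b.IsBilimit)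
    (hf : ∀ i, IsZero (f i) ∨ IsLocalRing (End (f i))) :
    ∃ (n : ℕ) (f : Fin n → C), (∀ i, IsLocalRing (End (f i))) ∧
      ∃ b' : Bicone f, Nonempty b'.IsBilimit ∧ Nonempty (b'.pt ≅ b.pt) := by
  classical
  let J := {i : Fin n // ¬ IsZero (f i)}
  let e : Fin (Fintype.card J) ≃ J := (Fintype.equivFin J).symm
  let b' : Bicone (fun j => f (e j).1) :=
    { pt := b.pt
      π := fun j => b.π (e j).1
      ι := fun j => b.ι (e j).1
      ι_π := fun i j => by
        split_ifs with hij
        · subst hij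
          simp
        · exact bicone_ι_π_ne b fun h => hij (e.injective (Subtype.ext h)) }
  refine ⟨_, _, fun j => (hf (e j).1).resolve_left (e j).2, b', ⟨isBilimitOfTotal b' ?_⟩,
    ⟨Iso.refl _⟩⟩
  change ∑ j, b.π (e j).1 ≫ b.ι (e j).1 = 𝟙 b.pt
  rw [e.sum_comp (fun j : J => b.π j.1 ≫ b.ι j.1), ← IsBilimit.total hb,
    ← Fintype.sum_subtype_add_sum_subtype (fun i => IsZero (f i))]
  refine (zero_add (∑ j : J, b.π j.1 ≫ b.ι j.1)).symm.trans ?_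
  congr 1
  exact (Finset.sum_eq_zero fun i _ => by rw [i.2.eq_of_tgt (b.π i.1) 0, zero_comp]).symm

end KrullSchmidt


/-! ### The simple minded system in the quotient. -/

section Quotient

variable {k : Type*} [Field k] {T : Type*} [Category* T] [Preadditive T] [Linear k T]
  [HasZeroObject T] [HasShift T ℤ] [∀ n : ℤ, (shiftFunctor T n).Additive]
  [Pretriangulated T] [IsTriangulated T]
  {P : ObjectProperty T} [P.IsTriangulated] {ι : Type*} {S : ι → T} {d : ℕ}

/-- Summands inherit the amplitude bounds, so `Q` is full on their endomorphisms; those that become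
zero are dropped. -/
lemma IsNegCYTriple.isKrullSchmidt_quotient (h : IsNegCYTriple k P S d) :
    IsKrullSchmidt (VerdierQuotient P) := by
  intro U
  obtain ⟨X, hX, hX', ⟨e⟩⟩ := h.exists_iso_obj U
  obtain ⟨n, f, hf, b, ⟨hb⟩, ⟨e'⟩⟩ := h.krullSchmidt X
  have hr (i : Fin n) : Retract (f i) X :=
    ⟨b.ι i ≫ e'.hom, e'.inv ≫ b.π i, by simp⟩
  obtain ⟨hQ⟩ := PreservesBiproduct.preserves (F := P.trW.Q) hb
  obtain ⟨m, g, hg, b', hb', ⟨e''⟩⟩ :=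
    exists_local_decomposition (P.trW.Q.mapBicone b) hQ (fun i => by
      refine or_iff_not_imp_left.2 fun h0 => isLocalRing_of_end_surjective _ (hf i) ?_ h0
      exact h.map_surjective 0 (rightOrthogonal_of_retract (hr i) hX)
        (by simpa using leftOrthogonal_of_retract (hr i) hX'))
  exact ⟨m, g, hg, b', hb', ⟨e'' ≪≫ P.trW.Q.mapIso e' ≪≫ e⟩⟩

/-- If `𝟙 X` dies in the quotient, it factors through an object of `P`, making `X` a retract of it.
-/
lemma prop_of_isZero_obj (hP : P.IsStableUnderRetracts) {X : T} (hX : IsZero (P.trW.Q.obj X)) :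
    P X := by
  obtain ⟨Z, s, hs, hs'⟩ := (MorphismProperty.map_eq_iff_precomp P.trW.Q P.trW (𝟙 X) 0).1
    (hX.eq_of_src _ _)
  obtain ⟨Y, g, w, hT, hY⟩ := hs
  obtain ⟨q, hq⟩ := exists_desc hT (𝟙 X) (by rw [hs', comp_zero])
  exact hP.of_retract ⟨g, q, hq⟩ hY

lemma IsNegCYTriple.map_surjective_simple (h : IsNegCYTriple k P S d) (i j : ι) {m : ℤ}
    (hm : m ≤ d) : Function.Surjective (P.trW.Q.map : ((S i)⟦m⟧ ⟶ S j) → _) := by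
  -- The bound `m - d ≤ 0` makes `S j` orthogonal to all shifts below it; this is where `m ≤ d`
  -- enters.
  refine h.map_surjective m (fun X f hX => ?_) (fun X f hX => ?_)
  · exact h.smc.homZero (J := {m}) (by simp) hX ⟨i, m, rfl, ⟨Iso.refl _⟩⟩ f
  · exact h.smc.homZero (I := {0}) (by simp; omega)
      ⟨j, 0, rfl, ⟨((shiftFunctorZero T ℤ).app (S j)).symm⟩⟩ hX f

lemma IsNegCYTriple.map_surjective_simple_zero (h : IsNegCYTriple k P S d) (i j : ι) :
    Function.Surjective (P.trW.Q.map : (S i ⟶ S j) → _) := by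
  intro f
  let e : (S i)⟦(0 : ℤ)⟧ ≅ S i := (shiftFunctorZero T ℤ).app (S i)
  obtain ⟨g, hg⟩ := h.map_surjective_simple i j (m := 0) (by omega) (P.trW.Q.map e.hom ≫ f)
  refine ⟨e.inv ≫ g, ?_⟩
  rw [Functor.map_comp, hg, ← Functor.map_comp_assoc, e.inv_hom_id, CategoryTheory.Functor.map_id,
    Category.id_comp]

lemma IsNegCYTriple.isSMS_quotient (h : IsNegCYTriple k P S d) (hd : 1 ≤ d) :
    IsSMS k (d + 1) (fun i => P.trW.Q.obj (S i)) where
  one_le := by omega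
  finrank_self i := by
    have h0 : 𝟙 (P.trW.Q.obj (S i)) ≠ 0 := fun h0 =>
      h.not_prop hd i (prop_of_isZero_obj h.retracts ((IsZero.iff_id_eq_zero _).2 h0))
    refine (finrank_eq_one_iff_of_nonzero' _ h0).2 fun f => ?_
    obtain ⟨g, rfl⟩ := h.map_surjective_simple_zero i i f
    obtain ⟨c, rfl⟩ := (finrank_eq_one_iff_of_nonzero' _ (h.smc.id_ne_zero i)).1
      (h.smc.finrank_self i) g
    exact ⟨c, by rw [Functor.map_smul, CategoryTheory.Functor.map_id]⟩
  finrank_of_ne i j hij := by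
    have := h.homFinite (S i) (S j)
    have := Module.finrank_zero_iff.1 (h.smc.finrank_of_ne i j hij)
    have : Subsingleton (P.trW.Q.obj (S i) ⟶ P.trW.Q.obj (S j)) :=
      (h.map_surjective_simple_zero i j).subsingleton
    exact Module.finrank_zero_of_subsingleton
  hom_shift i j m hm hm' f := by
    obtain ⟨g, hg⟩ := h.map_surjective_simple i j (m := m) (by push_cast at hm'; omega)
      ((P.trW.Q.commShiftIso m).hom.app (S i) ≫ f)
    have hg0 : g = 0 := h.smc.homZero (I := {m}) (J := {0}) (by simp; omega)
      ⟨i, m, rfl, ⟨Iso.refl _⟩⟩ ⟨j, 0, rfl, ⟨((shiftFunctorZero T ℤ).app (S j)).symm⟩⟩ g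
    rw [← cancel_epi ((P.trW.Q.commShiftIso m).hom.app (S i)), ← hg, hg0, Functor.map_zero,
      comp_zero]
  eq_top U := by
    obtain ⟨X, hX, hX', ⟨e⟩⟩ := h.exists_iso_obj U
    exact starProduct_of_iso _ _ e (starProduct_map P.trW.Q (heartShift_map P.trW.Q S) _ _
      (h.smc.starProduct_of_orthogonal h.homFinite d hX' hX))

end Quotient

end NegCluster

theorem theorem4p6 {k : Type*} [Field k] {T : Type*} [Category* T] [Preadditive T] [Linear k T]
    [HasZeroObject T] [HasShift T ℤ] [∀ n : ℤ, (shiftFunctor T n).Additive]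
    [∀ n : ℤ, (shiftFunctor T n).Linear k] [Pretriangulated T] [IsTriangulated T]
    (Tp : ObjectProperty T) [Tp.IsTriangulated] {ι : Type*} [Finite ι] (S : ι → T)
    (d : ℕ) (hd : 1 ≤ d) (h : NegCluster.IsNegCYTriple k Tp S d) :
    NegCluster.IsHomFinite k (NegCluster.VerdierQuotient Tp) ∧
    NegCluster.IsKrullSchmidt (NegCluster.VerdierQuotient Tp) ∧
    NegCluster.IsSMS k (d + 1) (fun i => Tp.trW.Q.obj (S i)) :=
  ⟨h.isHomFinite_quotient, h.isKrullSchmidt_quotient, h.isSMS_quotient hd⟩
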